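/- For $\alpha\in[1,2)$ and $\ell>0$ put $\nu_\alpha=\frac{\alpha-1}{2-\alpha}$ and $\kappa_\alpha=\frac{2-\alpha}{2}$, let $J_\nu$ be the Bessel function of the first kind of order $\nu\ge 0$, and let $0<j_{\nu,1}<j_{\nu,2}<\cdots$ be its positive zeros. For $m\ge 1$ let $$\Phi_{\alpha,m}(x)=\frac{\sqrt{2\kappa_\alpha}}{\ell^{\kappa_\alpha}\,|J'_{\nu_\alpha}(j_{\nu_\alpha,m})|}\;x^{\frac{1-\alpha}{2}}\,J_{\nu_\alpha}\Bigl(j_{\nu_\alpha,m}\bigl(\tfrac{x}{\ell}\bigr)^{\kappa_\alpha}\Bigr),\qquad x\in(0,\ell).$$ These are, up to sign, the $L^2(0,\ell)$-normalized real eigenfunctions of the operator $u\mapsto-(x^\alpha u')'$ on $L^2(0,\ell)$ whose domain consists of the $u\in L^2(0,\ell)$ that are locally absolutely continuous in $(0,\ell]$ with $x^{\alpha/2}u'\in L^2(0,\ell)$, $u(\ell)=0$ and $x^\alpha u'\in H^1(0,\ell)$ (then automatically $(x^\alpha u')(0)=0$). **Proposition.** Let $0<a<b<\ell$. There is a constant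 $\gamma_0^*=\gamma_0^*(a,b,\ell)>0$ such that $$\int_a^b\Phi_{\alpha,m}(x)^2\,dx\;\ge\;\gamma_0^*\,(2-\alpha)\qquad\text{for all }\alpha\in[1,2)\text{ and all }m\ge 1,$$ and, with the same constant, $\int_a^b \Phi(x)^2\,dx\ge\gamma_0^*(2-\alpha)$ for all $\alpha\in[1,2)$ and every real-valued eigenfunction $\Phi$ of this operator with $\int_0^\ell\Phi^2=1$. -/

import Mathlib

open MeasureTheory Set

noncomputable section

namespace DegenerateDiffusion

/-! ### Bessel functions of the first kind and their positive zeros -/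

/-- The Bessel function of the first kind of order `ν`,
`J_ν(y) = ∑_{m ≥ 0} (-1)^m / (m! Γ(m + ν + 1)) (y/2)^(2m + ν)`, for `ν ≥ 0` and `y ≥ 0`. -/
def besselJ (ν y : ℝ) : ℝ :=
  ∑' m : ℕ, (-1) ^ m / ((m.factorial : ℝ) * Real.Gamma (m + ν + 1)) *
    (y / 2) ^ (2 * (m : ℝ) + ν)

/-- `besselZero ν n`, for `n ≥ 1`, is the `n`-th positive zero `j_{ν,n}` of `J_ν`: the first zero
of `J_ν` after `j_{ν,n-1}`, starting from the convention `j_{ν,0} = 0`. -/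
def besselZero (ν : ℝ) : ℕ → ℝ
  | 0 => 0
  | n + 1 => sInf {y : ℝ | besselZero ν n < y ∧ besselJ ν y = 0}

/-- `ν_α = (α - 1) / (2 - α)`. -/
def nuIndex (α : ℝ) : ℝ := (α - 1) / (2 - α)

/-- `κ_α = (2 - α) / 2`. -/
def kappa (α : ℝ) : ℝ := (2 - α) / 2

/-- The function `Φ_{α,m}` on `(0, ℓ)`, for `m ≥ 1`:
`√(2 κ_α) / (ℓ^{κ_α} |J_{ν_α}'(j_{ν_α,m})|) x^{(1-α)/2} J_{ν_α}(j_{ν_α,m} (x/ℓ)^{κ_α})`. -/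
def eigenPhi (ℓ α : ℝ) (m : ℕ) (x : ℝ) : ℝ :=
  Real.sqrt (2 * kappa α) /
      (ℓ ^ kappa α * |deriv (besselJ (nuIndex α)) (besselZero (nuIndex α) m)|) *
    x ^ ((1 - α) / 2) *
    besselJ (nuIndex α) (besselZero (nuIndex α) m * (x / ℓ) ^ kappa α)

/-! ### The operator `u ↦ (x^α u')'` on `L²(0, ℓ)` and its domain -/

/-- `f ∈ L²(0, ℓ)`. -/
def MemL2 (ℓ : ℝ) (f : ℝ → ℝ) : Prop :=
  MemLp f 2 (volume.restrict (Ioo 0 ℓ))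

/-- `f ∈ H¹(0, ℓ)` with (weak) derivative `f'`: `f` and `f'` are in `L²(0, ℓ)`, and `f` agrees
almost everywhere on `(0, ℓ)` with an absolutely continuous function on `[0, ℓ]` whose almost
everywhere derivative is `f'`. -/
def HasH1Deriv (ℓ : ℝ) (f f' : ℝ → ℝ) : Prop :=
  MemL2 ℓ f ∧ MemL2 ℓ f' ∧
    ∃ g : ℝ → ℝ, AbsolutelyContinuousOnInterval g 0 ℓ ∧
      (∀ᵐ x ∂(volume.restrict (Ioo 0 ℓ)), f x = g x) ∧
      (∀ᵐ x ∂(volume.restrict (Ioo 0 ℓ)), HasDerivAt g (f' x) x)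

/-- The flux `x ↦ x^α u'(x)`. -/
def flux (α : ℝ) (u : ℝ → ℝ) (x : ℝ) : ℝ := x ^ α * deriv u x

/-- The weighted space `H¹_α(0, ℓ)`: `u ∈ L²(0, ℓ)`, `u` is locally absolutely continuous in
`(0, ℓ]`, and `x^{α/2} u' ∈ L²(0, ℓ)`. -/
def MemH1α (ℓ α : ℝ) (u : ℝ → ℝ) : Prop :=
  MemL2 ℓ u ∧
    (∀ ε : ℝ, 0 < ε → ε < ℓ → AbsolutelyContinuousOnInterval u ε ℓ) ∧
    MemL2 ℓ (fun x => x ^ (α / 2) * deriv u x)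

/-- `H¹_{α,0}(0, ℓ)`: the functions of `H¹_α(0, ℓ)` that vanish at `ℓ`. -/
def MemH1αZero (ℓ α : ℝ) (u : ℝ → ℝ) : Prop :=
  MemH1α ℓ α u ∧ u ℓ = 0

/-- The graph of the operator `A u = (x^α u')'`, with domain
`D(A) = {u ∈ H¹_{α,0}(0, ℓ) | x^α u' ∈ H¹(0, ℓ)}`: `u ∈ D(A)` and `A u = f`. For `α ≥ 1`
the Neumann condition `(x^α u')(0) = 0` holds for every `u` in `D(A)`. -/
def OperatorGraph (ℓ α : ℝ) (u f : ℝ → ℝ) : Prop :=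
  MemH1αZero ℓ α u ∧ HasH1Deriv ℓ (flux α u) f

/-- `u` is an eigenfunction of `u ↦ -(x^α u')'` on `(0, ℓ)`, for the eigenvalue `μ`, that is
normalized in `L²(0, ℓ)`. -/
def IsNormalizedEigenfunction (ℓ α μ : ℝ) (u : ℝ → ℝ) : Prop :=
  OperatorGraph ℓ α u (fun x => -(μ * u x)) ∧ ∫ x in (0 : ℝ)..ℓ, u x ^ 2 = 1

end DegenerateDiffusion

end

/-! With p = x^α u', the equation becomes u' = x^{-α} p, p' = -μ u, and three explicit derivatives
give the bound. The energy density E = x^{-α} p² + μ u² is nonincreasing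
(`energyDensity_antitoneOn`), so E ≥ E(ℓ) on (a, b). The Pohozaev quantity x E + (α-1) p u has
derivative (2-α) μ u², so normalization yields ℓ E(ℓ) ≥ (2-α) μ (`le_energyDensity_boundary`); this
is the source of the factor 2-α. Lastly (p u)' = x^{-α} p² - μ u²: tested against a cutoff on (a,
b), it bounds the kinetic part of E by μ ∫ u² plus an error in ∫ u² that lacks the factor μ. The
Hardy bound 4 ℓ^{2-α} μ ≥ 1 (`one_le_eigenvalue`) absorbs this error, and μ cancels
(`IsFluxSolution.mass_lower_bound`). None of these estimates involves the Bessel order, so the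
constant is uniform although ν_α → ∞ as α → 2.

At the endpoint 0 it suffices that p u ≥ -δ at points arbitrarily close to 0. For an eigenfunction
in the operator domain, p(0) = 0 and p = O(√x), so p u < -δ near 0 would make u² dominate a multiple
of 1/x.

For Φ_{α,m} the normalization integral is never computed: the prefactor gives ℓ E(ℓ) = (2-α) μ
exactly. This needs only that j_{ν,m} is a positive zero of J_ν with J_ν' ≠ 0 there; such zeros
exist by Sturm comparison. -/

namespace DegenerateDiffusion

/-! ### Energy, Hardy and Pohozaev identities for the first order system -/

/-- The first order system `u' = x^{-α} p`, `p' = -μ u` on `(0, ℓ)` with `u(ℓ) = 0`, for functions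
that are continuous up to `ℓ`. -/
structure IsFluxSolution (ℓ α μ : ℝ) (u p : ℝ → ℝ) : Prop where
  continuousOn_left : ContinuousOn u (Ioc 0 ℓ)
  continuousOn_right : ContinuousOn p (Ioc 0 ℓ)
  hasDerivAt_left : ∀ x ∈ Ioo 0 ℓ, HasDerivAt u (x ^ (-α) * p x) x
  hasDerivAt_right : ∀ x ∈ Ioo 0 ℓ, HasDerivAt p (-(μ * u x)) x
  boundary : u ℓ = 0

/-- The energy density `x^α u'² + μ u² = x^{-α} p² + μ u²`. -/
noncomputable def energyDensity (α μ : ℝ) (u p : ℝ → ℝ) (x : ℝ) : ℝ :=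
  x ^ (-α) * p x ^ 2 + μ * u x ^ 2

/-- The product `p u` has a nonnegative upper limit at `0`. -/
def FluxProductLimsupNonneg (u p : ℝ → ℝ) : Prop :=
  ∀ δ : ℝ, 0 < δ → ∀ r : ℝ, 0 < r → ∃ x, 0 < x ∧ x < r ∧ -δ ≤ p x * u x

lemma hasDerivAt_rpow_neg (α : ℝ) {x : ℝ} (hx : 0 < x) :
    HasDerivAt (fun y : ℝ => y ^ (-α)) (-α * (x ^ (-α) / x)) x := by
  have h := Real.hasDerivAt_rpow_const (x := x) (p := -α) (Or.inl hx.ne')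
  rwa [Real.rpow_sub_one hx.ne'] at h

lemma continuousOn_rpow_neg (α ℓ : ℝ) : ContinuousOn (fun y : ℝ => y ^ (-α)) (Ioc 0 ℓ) :=
  continuousOn_id.rpow_const fun _ hx => Or.inl hx.1.ne'

/-- A function on `(0, ℓ]` with nonnegative derivative in the interior is monotone. -/
lemma monotoneOn_Ioc_of_hasDerivAt {ℓ : ℝ} {f f' : ℝ → ℝ} (hc : ContinuousOn f (Ioc 0 ℓ))
    (hd : ∀ x ∈ Ioo 0 ℓ, HasDerivAt f (f' x) x) (h0 : ∀ x ∈ Ioo 0 ℓ, 0 ≤ f' x) :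
    MonotoneOn f (Ioc 0 ℓ) := by
  refine monotoneOn_of_deriv_nonneg (convex_Ioc 0 ℓ) hc ?_ ?_ <;> rw [interior_Ioc]
  · exact fun x hx => (hd x hx).differentiableAt.differentiableWithinAt
  · exact fun x hx => by rw [(hd x hx).deriv]; exact h0 x hx

namespace IsFluxSolution

variable {ℓ α μ : ℝ} {u p : ℝ → ℝ}

lemma continuousOn_energyDensity (h : IsFluxSolution ℓ α μ u p) :
    ContinuousOn (energyDensity α μ u p) (Ioc 0 ℓ) :=
  ((continuousOn_rpow_neg α ℓ).mul (h.continuousOn_right.pow 2)).add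
    ((h.continuousOn_left.pow 2).const_smul μ)

/-- The cross terms ±2 μ x^{-α} p u cancel, so only the derivative of the weight survives. -/
lemma hasDerivAt_energyDensity (h : IsFluxSolution ℓ α μ u p) {x : ℝ} (hx : x ∈ Ioo 0 ℓ) :
    HasDerivAt (energyDensity α μ u p) (-α * (x ^ (-α) / x) * p x ^ 2) x := by
  have h1 := ((hasDerivAt_rpow_neg α hx.1).mul ((h.hasDerivAt_right x hx).pow 2)).add
    (((h.hasDerivAt_left x hx).pow 2).const_mul μ)
  refine h1.congr_deriv ?_
  simp only [Pi.pow_apply]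
  push_cast
  ring

lemma hasDerivAt_mul (h : IsFluxSolution ℓ α μ u p) {x : ℝ} (hx : x ∈ Ioo 0 ℓ) :
    HasDerivAt (fun y => p y * u y) (x ^ (-α) * p x ^ 2 - μ * u x ^ 2) x := by
  refine ((h.hasDerivAt_right x hx).mul (h.hasDerivAt_left x hx)).congr_deriv ?_
  ring

lemma energyDensity_antitoneOn (h : IsFluxSolution ℓ α μ u p) (hα : 0 ≤ α) :
    AntitoneOn (energyDensity α μ u p) (Ioc 0 ℓ) := by
  have : MonotoneOn (fun x => -energyDensity α μ u p x) (Ioc 0 ℓ) := by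
    refine monotoneOn_Ioc_of_hasDerivAt h.continuousOn_energyDensity.neg
      (fun x hx => (h.hasDerivAt_energyDensity hx).neg) fun x hx => ?_
    have := Real.rpow_nonneg hx.1.le (-α)
    have hx0 := hx.1
    rw [neg_mul, neg_mul, neg_neg]
    positivity
  intro x hx y hy hxy
  have := this hx hy hxy
  simp only at this
  linarith

/-- The quantity is x^α times the energy density; the increasing weight reverses the monotonicity.
For μ > 0 it serves as backward uniqueness: if u and p both vanish at ℓ, then u vanishes on (0, ℓ].
-/
lemma monotoneOn_sq_add (h : IsFluxSolution ℓ α μ u p) (hα : 0 ≤ α) (hμ : 0 ≤ μ) :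
    MonotoneOn (fun x => p x ^ 2 + μ * (x ^ α * u x ^ 2)) (Ioc 0 ℓ) := by
  have hc : ContinuousOn (fun x : ℝ => x ^ α) (Ioc 0 ℓ) :=
    continuousOn_id.rpow_const fun _ hx => Or.inl hx.1.ne'
  refine monotoneOn_Ioc_of_hasDerivAt (f' := fun x => μ * α * (x ^ α / x) * u x ^ 2)
    ((h.continuousOn_right.pow 2).add
      (continuousOn_const.mul (hc.mul (h.continuousOn_left.pow 2)))) (fun x hx => ?_)
    fun x hx => ?_
  · have hpow := Real.hasDerivAt_rpow_const (x := x) (p := α) (Or.inl hx.1.ne')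
    rw [Real.rpow_sub_one hx.1.ne'] at hpow
    have e : x ^ α * x ^ (-α) = 1 := by rw [← Real.rpow_add hx.1]; simp
    refine (((h.hasDerivAt_right x hx).pow 2).add
      ((hpow.mul ((h.hasDerivAt_left x hx).pow 2)).const_mul μ)).congr_deriv ?_
    simp only [Pi.pow_apply]
    push_cast
    linear_combination (2 * μ * u x * p x) * e
  · have hx0 := hx.1
    have := Real.rpow_nonneg hx0.le α
    positivity

/-- Hardy's inequality, as a lower bound for the eigenvalue. -/
lemma one_le_eigenvalue (h : IsFluxSolution ℓ α μ u p) (hα2 : α < 2)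
    (hlim : FluxProductLimsupNonneg u p) (hu : ∃ x ∈ Ioo 0 ℓ, u x ≠ 0) :
    1 ≤ 4 * ℓ ^ (2 - α) * μ := by
  by_contra! hlt
  obtain ⟨x₀, hx₀, hne⟩ := hu
  have hℓ : 0 < ℓ := hx₀.1.trans hx₀.2
  set Λ := ℓ ^ (2 - α) with hΛ
  have hΛ0 : 0 < Λ := Real.rpow_pos_of_pos hℓ _
  -- The term 2 x u² vanishes at ℓ and is nonnegative near 0. Its derivative supplies the cross term
  -- that completes the square with x^{-α} p², using x^{2-α} ≤ Λ.
  set N : ℝ → ℝ := fun x => 4 * Λ * (p x * u x) + 2 * (x * u x ^ 2) with hN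
  have hd : ∀ x ∈ Ioo 0 ℓ, HasDerivAt N (4 * Λ * (x ^ (-α) * p x ^ 2 - μ * u x ^ 2) +
      2 * (u x ^ 2 + x * (2 * u x * (x ^ (-α) * p x)))) x := by
    intro x hx
    have h1 := ((h.hasDerivAt_mul hx).const_mul (4 * Λ)).add
      (((hasDerivAt_id x).mul ((h.hasDerivAt_left x hx).pow 2)).const_mul 2)
    refine h1.congr_deriv ?_
    simp
  have hlow : ∀ x ∈ Ioo 0 ℓ, (1 - 4 * Λ * μ) * u x ^ 2 ≤
      4 * Λ * (x ^ (-α) * p x ^ 2 - μ * u x ^ 2) +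
      2 * (u x ^ 2 + x * (2 * u x * (x ^ (-α) * p x))) := by
    intro x hx
    have hA : 0 < x ^ (-α) := Real.rpow_pos_of_pos hx.1 _
    have hle : x ^ 2 * x ^ (-α) ≤ Λ := by
      have : x ^ 2 * x ^ (-α) = x ^ (2 - α) := by
        rw [sub_eq_add_neg, Real.rpow_add hx.1]; norm_num
      rw [this]
      exact Real.rpow_le_rpow hx.1.le hx.2.le (by linarith)
    have h2 : x ^ 2 * x ^ (-α) * (x ^ (-α) * p x ^ 2) ≤ Λ * (x ^ (-α) * p x ^ 2) :=
      mul_le_mul_of_nonneg_right hle (by positivity)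
    nlinarith [sq_nonneg (2 * (x * x ^ (-α) * p x) + u x)]
  have hmono : MonotoneOn N (Ioc 0 ℓ) := by
    refine monotoneOn_Ioc_of_hasDerivAt ?_ hd fun x hx =>
      (mul_nonneg (by linarith) (sq_nonneg _)).trans (hlow x hx)
    exact (continuousOn_const.mul (h.continuousOn_right.mul h.continuousOn_left)).add
      (continuousOn_const.mul (continuousOn_id.mul (h.continuousOn_left.pow 2)))
  have hNℓ : N ℓ = 0 := by simp [hN, h.boundary]
  have hzero : ∀ x ∈ Ioo 0 ℓ, N x = 0 := by
    intro x hx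
    have hle : N x ≤ 0 := hNℓ ▸ hmono ⟨hx.1, hx.2.le⟩ ⟨hℓ, le_rfl⟩ hx.2.le
    by_contra hne'
    have hneg : 0 < -N x := by
      have := lt_of_le_of_ne hle hne'
      linarith
    -- The tolerance makes 4Λ p u ≥ N x / 2 at y, hence N y ≥ N x / 2 > N x, against monotonicity.
    obtain ⟨y, hy0, hyx, hy⟩ := hlim (-N x / (8 * Λ)) (by positivity) x hx.1
    have h1 : N y ≤ N x := hmono ⟨hy0, (hyx.trans hx.2).le⟩ ⟨hx.1, hx.2.le⟩ hyx.le
    have h2 : N x / 2 ≤ 4 * Λ * (p y * u y) := by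
      have := mul_le_mul_of_nonneg_left hy (show 0 ≤ 4 * Λ by positivity)
      have e : 4 * Λ * -(-N x / (8 * Λ)) = N x / 2 := by field_simp; ring
      linarith
    have h3 : 0 ≤ 2 * (y * u y ^ 2) := by positivity
    have h4 : N y = 4 * Λ * (p y * u y) + 2 * (y * u y ^ 2) := rfl
    linarith
  have hd0 : HasDerivAt N 0 x₀ := by
    refine (hasDerivAt_const x₀ (0 : ℝ)).congr_of_eventuallyEq ?_
    filter_upwards [isOpen_Ioo.mem_nhds hx₀] with x hx using hzero x hx
  have heq := (hd x₀ hx₀).unique hd0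
  have := hlow x₀ hx₀
  rw [heq] at this
  have hpos : 0 < (1 - 4 * Λ * μ) * u x₀ ^ 2 := mul_pos (by linarith) (by positivity)
  linarith

/-- The Pohozaev identity, as a lower bound for the flux at `ℓ`. -/
lemma le_energyDensity_boundary (h : IsFluxSolution ℓ α μ u p) (hα1 : 1 ≤ α)
    (hℓ : 0 < ℓ) (hμ : 0 ≤ μ) (hlim : FluxProductLimsupNonneg u p)
    (hint : IntervalIntegrable (fun x => u x ^ 2) volume 0 ℓ) :
    (2 - α) * μ * ∫ x in (0 : ℝ)..ℓ, u x ^ 2 ≤ ℓ * energyDensity α μ u p ℓ := by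
  -- Since (x E)' = (1-α) x^{-α} p² + μ u², the coefficient α-1 of p u is the one that removes p²
  -- from the derivative.
  set M : ℝ → ℝ := fun x => x * energyDensity α μ u p x + (α - 1) * (p x * u x) with hM
  have hMc : ContinuousOn M (Ioc 0 ℓ) :=
    (continuousOn_id.mul h.continuousOn_energyDensity).add
      (continuousOn_const.mul (h.continuousOn_right.mul h.continuousOn_left))
  have hd : ∀ x ∈ Ioo 0 ℓ, HasDerivAt M ((2 - α) * μ * u x ^ 2) x := by
    intro x hx
    have h1 := ((hasDerivAt_id x).mul (h.hasDerivAt_energyDensity hx)).add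
      ((h.hasDerivAt_mul hx).const_mul (α - 1))
    refine h1.congr_deriv ?_
    have hx0 := hx.1.ne'
    simp only [id, energyDensity]
    field_simp
    ring
  have hftc : ∀ ε ∈ Ioo 0 ℓ, ∫ x in ε..ℓ, (2 - α) * μ * u x ^ 2 = M ℓ - M ε := by
    intro ε hε
    refine intervalIntegral.integral_eq_sub_of_hasDerivAt_of_le hε.2.le
      (hMc.mono fun x hx => ⟨hε.1.trans_le hx.1, hx.2⟩)
      (fun x hx => hd x ⟨hε.1.trans hx.1, hx.2⟩) ?_
    refine (hint.mono_set ?_).const_mul _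
    rw [uIcc_of_le hε.2.le, uIcc_of_le hℓ.le]
    exact Icc_subset_Icc_left hε.1.le
  have hMℓ : M ℓ = ℓ * energyDensity α μ u p ℓ := by simp [hM, h.boundary]
  rw [← hMℓ, ← intervalIntegral.integral_const_mul]
  have hint' := hint.const_mul ((2 - α) * μ)
  have hcont : ContinuousOn (fun ε => ∫ x in ε..ℓ, (2 - α) * μ * u x ^ 2) (Icc 0 ℓ) := by
    have := intervalIntegral.continuousOn_primitive_interval_left
      (f := fun x => (2 - α) * μ * u x ^ 2) (μ := volume) (a := 0) (b := ℓ)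
      (by rwa [uIcc_of_le hℓ.le, ← intervalIntegrable_iff_integrableOn_Icc_of_le hℓ.le])
    rwa [uIcc_of_le hℓ.le] at this
  refine le_of_forall_pos_le_add fun δ hδ => ?_
  have hat := hcont 0 ⟨le_rfl, hℓ.le⟩
  -- Half of δ pays for truncating the integral at ε, the other half for the boundary term (α-1) p u
  -- at ε; the 1 added to |α-1| below covers α = 1.
  obtain ⟨r, hr, hball⟩ := Metric.continuousWithinAt_iff.1 hat (δ / 2) (by positivity)
  obtain ⟨ε, hε0, hεr, hε⟩ := hlim (δ / (2 * (|α - 1| + 1))) (by positivity) (min r ℓ)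
    (lt_min hr hℓ)
  have hεℓ : ε < ℓ := hεr.trans_le (min_le_right _ _)
  have h1 := hball (x := ε) ⟨hε0.le, hεℓ.le⟩
    (by rw [Real.dist_eq, sub_zero, abs_of_pos hε0]; exact hεr.trans_le (min_le_left _ _))
  rw [Real.dist_eq, abs_lt, hftc ε ⟨hε0, hεℓ⟩] at h1
  have h2 : -(δ / 2) ≤ (α - 1) * (p ε * u ε) := by
    have := mul_le_mul_of_nonneg_left hε (sub_nonneg.2 hα1)
    have h3 : (α - 1) * (δ / (2 * (|α - 1| + 1))) ≤ δ / 2 := by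
      rw [abs_of_nonneg (sub_nonneg.2 hα1)]
      rw [mul_div_assoc', div_le_div_iff₀ (by linarith) (by norm_num)]
      nlinarith
    linarith
  have h3 : 0 ≤ ε * energyDensity α μ u p ε := by
    have := Real.rpow_nonneg hε0.le (-α)
    unfold energyDensity
    positivity
  have h4 : M ε = ε * energyDensity α μ u p ε + (α - 1) * (p ε * u ε) := rfl
  linarith [h1.1]

end IsFluxSolution

/-! ### Localized equipartition of energy on (a, b) -/

/-- The constant of the lower bound for the mass in `(a, b)`. -/
noncomputable def massConstant (a b ℓ : ℝ) : ℝ :=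
  (∫ x in a..b, ((x - a) * (b - x)) ^ 2) /
    (ℓ * (3 * (b - a) ^ 4 + 16 * max 1 ℓ ^ 3 * (b - a) ^ 2))

lemma massConstant_pos {a b ℓ : ℝ} (hab : a < b) (hℓ : 0 < ℓ) : 0 < massConstant a b ℓ := by
  have hba : 0 < b - a := sub_pos.2 hab
  have hmax : (0 : ℝ) < max 1 ℓ := lt_max_of_lt_left one_pos
  refine div_pos ?_ (by positivity)
  refine intervalIntegral.intervalIntegral_pos_of_pos_on
    (Continuous.intervalIntegrable (by fun_prop) _ _) (fun x hx => ?_) hab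
  have := mul_pos (sub_pos.2 hx.1) (sub_pos.2 hx.2)
  positivity

/-- Replaces powers depending on α by powers of max 1 ℓ, so that the final constant does not depend
on α. -/
lemma rpow_le_max_one {x ℓ s : ℝ} {n : ℕ} (hx : 0 < x) (hxℓ : x ≤ ℓ) (hs : 0 ≤ s) (hn : s ≤ n) :
    x ^ s ≤ max 1 ℓ ^ n := by
  calc x ^ s ≤ max 1 ℓ ^ s := Real.rpow_le_rpow hx.le (hxℓ.trans (le_max_right _ _)) hs
    _ ≤ max 1 ℓ ^ (n : ℝ) := Real.rpow_le_rpow_of_exponent_le (le_max_left _ _) hn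
    _ = max 1 ℓ ^ n := Real.rpow_natCast _ _

/-- The mass of a solution in `(a, b)` is bounded below by the flux at `ℓ`. -/
theorem IsFluxSolution.mass_lower_bound {a b ℓ α μ : ℝ} {u p : ℝ → ℝ}
    (h : IsFluxSolution ℓ α μ u p) (ha : 0 < a) (hab : a < b) (hbℓ : b < ℓ) (hα1 : 1 ≤ α)
    (hα2 : α < 2) (hμ : 1 ≤ 4 * ℓ ^ (2 - α) * μ)
    (hE : (2 - α) * μ ≤ ℓ * energyDensity α μ u p ℓ) :
    massConstant a b ℓ * (2 - α) ≤ ∫ x in a..b, u x ^ 2 := by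
  have hℓ : 0 < ℓ := ha.trans (hab.trans hbℓ)
  have hba : 0 < b - a := sub_pos.2 hab
  set L := max 1 ℓ with hL
  have hL1 : 1 ≤ L := le_max_left _ _
  have hμ0 : 0 < μ := by
    by_contra! hle
    have : 4 * ℓ ^ (2 - α) * μ ≤ 0 :=
      mul_nonpos_of_nonneg_of_nonpos (by positivity) hle
    linarith
  have hμL : 1 ≤ 4 * L * μ := by
    have h1 : ℓ ^ (2 - α) ≤ L ^ 1 :=
      rpow_le_max_one hℓ le_rfl (by linarith) (by norm_num; linarith)
    rw [pow_one] at h1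
    nlinarith
  -- In C μ / 2, the part 3/2 (b-a)⁴ μ is the term -μ η² u² of g' together with the half lost when
  -- E/2 replaces x^{-α} p² / 2. The part 8 L³ (b-a)² μ bounds the Young remainder 2 η'² x^α, with
  -- x^α ≤ L² and 1 ≤ 4 L μ.
  set C := 3 * (b - a) ^ 4 + 16 * L ^ 3 * (b - a) ^ 2 with hC
  have hC0 : 0 < C := by positivity
  have hsub : Icc a b ⊆ Ioc 0 ℓ := fun x hx => ⟨ha.trans_le hx.1, hx.2.trans hbℓ.le⟩
  have hsub' : Icc a b ⊆ Ioo 0 ℓ := fun x hx => ⟨ha.trans_le hx.1, hx.2.trans_lt hbℓ⟩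
  have hlow : ∀ x ∈ Icc a b, (2 - α) * μ / ℓ ≤ energyDensity α μ u p x := by
    intro x hx
    refine le_trans ?_ (h.energyDensity_antitoneOn (by linarith) (hsub hx) ⟨hℓ, le_rfl⟩
      (hsub hx).2)
    rw [div_le_iff₀ hℓ]
    linarith
  set η : ℝ → ℝ := fun x => (x - a) * (b - x) with hη
  have hηd : ∀ x, HasDerivAt η (a + b - 2 * x) x := by
    intro x
    refine (((hasDerivAt_id x).sub_const a).mul ((hasDerivAt_id x).const_sub b)).congr_deriv ?_
    simp
    ring
  set g' : ℝ → ℝ := fun x => 2 * η x * (a + b - 2 * x) * (p x * u x) +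
    η x ^ 2 * (x ^ (-α) * p x ^ 2 - μ * u x ^ 2) with hg'
  have hd : ∀ x ∈ Icc a b, HasDerivAt (fun y => η y ^ 2 * (p y * u y)) (g' x) x := by
    intro x hx
    refine (((hηd x).pow 2).mul (h.hasDerivAt_mul (hsub' hx))).congr_deriv ?_
    simp [hg']
  have hηc : Continuous η := by fun_prop
  have hg'c : ContinuousOn g' (Icc a b) := by
    have hpc := h.continuousOn_right.mono hsub
    have huc := h.continuousOn_left.mono hsub
    have hAc := (continuousOn_rpow_neg α ℓ).mono hsub
    have := hηc.continuousOn (s := Icc a b)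
    fun_prop
  have hftc : ∫ x in a..b, g' x = 0 := by
    rw [intervalIntegral.integral_eq_sub_of_hasDerivAt_of_le hab.le
      (fun x hx => (hd x hx).continuousAt.continuousWithinAt)
      (fun x hx => hd x ⟨hx.1.le, hx.2.le⟩) (hg'c.intervalIntegrable_of_Icc hab.le)]
    simp [hη]
  have hpt : ∀ x ∈ Icc a b,
      (2 - α) * μ / (2 * ℓ) * η x ^ 2 - C * μ / 2 * u x ^ 2 ≤ g' x := by
    intro x hx
    have hx0 := (hsub hx).1
    have hAα : x ^ (-α) * x ^ α = 1 := by rw [← Real.rpow_add hx0]; simp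
    have hA : 0 < x ^ (-α) := Real.rpow_pos_of_pos hx0 _
    have hB : 0 < x ^ α := Real.rpow_pos_of_pos hx0 _
    have hBL : x ^ α ≤ L ^ 2 :=
      rpow_le_max_one hx0 (hsub hx).2 (by linarith) (by norm_num; linarith)
    have hE' := mul_le_mul_of_nonneg_left (hlow x hx) (sq_nonneg (η x))
    have hη0 : 0 ≤ η x := mul_nonneg (sub_nonneg.2 hx.1) (sub_nonneg.2 hx.2)
    have hη2 : η x ^ 2 ≤ (b - a) ^ 4 := by
      have : η x ≤ (b - a) * (b - a) :=
        mul_le_mul (by linarith [hx.2]) (by linarith [hx.1]) (sub_nonneg.2 hx.2) hba.le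
      calc η x ^ 2 ≤ ((b - a) * (b - a)) ^ 2 := pow_le_pow_left₀ hη0 this 2
        _ = (b - a) ^ 4 := by ring
    have hη' : (a + b - 2 * x) ^ 2 ≤ (b - a) ^ 2 := by nlinarith [hx.1, hx.2]
    -- Young's inequality weighted by x^α; it costs half of the kinetic term.
    have hcross : -(η x ^ 2 * (x ^ (-α) * p x ^ 2) / 2 +
        2 * ((a + b - 2 * x) ^ 2 * x ^ α * u x ^ 2)) ≤
        2 * η x * (a + b - 2 * x) * (p x * u x) := by
      have := mul_nonneg hA.le
        (sq_nonneg (η x * p x + 2 * (a + b - 2 * x) * x ^ α * u x))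
      have e : x ^ (-α) * (η x * p x + 2 * (a + b - 2 * x) * x ^ α * u x) ^ 2 =
          η x ^ 2 * (x ^ (-α) * p x ^ 2) +
          (x ^ (-α) * x ^ α) * (4 * η x * (a + b - 2 * x) * (p x * u x)) +
          (x ^ (-α) * x ^ α) * (4 * ((a + b - 2 * x) ^ 2 * x ^ α * u x ^ 2)) := by ring
      rw [e, hAα] at this
      linarith
    have h1 : μ * η x ^ 2 * u x ^ 2 ≤ μ * (b - a) ^ 4 * u x ^ 2 := by gcongr
    have h2 : (a + b - 2 * x) ^ 2 * x ^ α * u x ^ 2 ≤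
        (b - a) ^ 2 * (L ^ 2 * (4 * L * μ)) * u x ^ 2 := by
      gcongr
      nlinarith [sq_nonneg L]
    have e1 : (2 - α) * μ / (2 * ℓ) * η x ^ 2 = η x ^ 2 * ((2 - α) * μ / ℓ) / 2 := by
      field_simp
    have e2 : η x ^ 2 * energyDensity α μ u p x =
        η x ^ 2 * (x ^ (-α) * p x ^ 2) + μ * η x ^ 2 * u x ^ 2 := by
      unfold energyDensity; ring
    have e3 : g' x = 2 * η x * (a + b - 2 * x) * (p x * u x) +
        η x ^ 2 * (x ^ (-α) * p x ^ 2) - μ * η x ^ 2 * u x ^ 2 := by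
      simp only [hg']; ring
    have e4 : C * μ / 2 * u x ^ 2 = 3 / 2 * (μ * (b - a) ^ 4 * u x ^ 2) +
        2 * ((b - a) ^ 2 * (L ^ 2 * (4 * L * μ)) * u x ^ 2) := by
      simp only [hC]; ring
    rw [e1, e3, e4]
    linarith
  have hi1 : IntervalIntegrable (fun x => (2 - α) * μ / (2 * ℓ) * η x ^ 2) volume a b :=
    Continuous.intervalIntegrable (by fun_prop) _ _
  have hi2 : IntervalIntegrable (fun x => C * μ / 2 * u x ^ 2) volume a b :=
    ContinuousOn.intervalIntegrable_of_Icc hab.le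
      (continuousOn_const.mul ((h.continuousOn_left.mono hsub).pow 2))
  have hmain := intervalIntegral.integral_mono_on hab.le (hi1.sub hi2)
    (hg'c.intervalIntegrable_of_Icc hab.le) hpt
  rw [hftc, intervalIntegral.integral_sub hi1 hi2, intervalIntegral.integral_const_mul,
    intervalIntegral.integral_const_mul] at hmain
  have hfin : (2 - α) * (∫ x in a..b, η x ^ 2) ≤ ℓ * C * ∫ x in a..b, u x ^ 2 := by
    have e : (2 - α) * μ / (2 * ℓ) * (∫ x in a..b, η x ^ 2) -
        C * μ / 2 * (∫ x in a..b, u x ^ 2) = μ / (2 * ℓ) *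
        ((2 - α) * (∫ x in a..b, η x ^ 2) - ℓ * C * ∫ x in a..b, u x ^ 2) := by
      field_simp
    rw [e] at hmain
    have := nonpos_of_mul_nonpos_right hmain (by positivity)
    linarith
  unfold massConstant
  rw [div_mul_eq_mul_div, div_le_iff₀ (by positivity)]
  linarith

/-! ### Regularity of weak eigenfunctions and their behaviour at 0 -/

/-- An absolutely continuous function whose derivative agrees almost everywhere with a continuous
function is differentiable. -/
lemma hasDerivAt_of_absolutelyContinuous {f φ : ℝ → ℝ} {c d : ℝ}
    (hf : AbsolutelyContinuousOnInterval f c d) (hφ : ContinuousOn φ (Icc c d))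
    (hae : ∀ᵐ x ∂(volume.restrict (Ioo c d)), deriv f x = φ x) {x : ℝ} (hx : x ∈ Ioo c d) :
    HasDerivAt f (φ x) x := by
  have hcd : c ≤ d := (hx.1.trans hx.2).le
  have heq : ∀ y ∈ Icc c d, f y = f c + ∫ t in c..y, φ t := by
    intro y hy
    have h1 := (hf.mono (c := c) (d := y)
      (by rw [uIcc_of_le hy.1, uIcc_of_le hcd]; exact Icc_subset_Icc_right hy.2)).integral_deriv_eq_sub
    have h2 : ∫ t in c..y, deriv f t = ∫ t in c..y, φ t := by
      rw [intervalIntegral.integral_of_le hy.1, intervalIntegral.integral_of_le hy.1,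
        integral_Ioc_eq_integral_Ioo, integral_Ioc_eq_integral_Ioo]
      exact integral_congr_ae (ae_restrict_of_ae_restrict_of_subset (Ioo_subset_Ioo_right hy.2) hae)
    rw [← h2, h1]
    ring
  have hint : IntervalIntegrable φ volume c x :=
    (hφ.mono (Icc_subset_Icc_right hx.2.le)).intervalIntegrable_of_Icc hx.1.le
  have hmem := isOpen_Ioo.mem_nhds hx
  have hd := intervalIntegral.integral_hasDerivAt_right hint
    ((hφ.mono Ioo_subset_Icc_self).stronglyMeasurableAtFilter isOpen_Ioo x hx)
    (hφ.continuousAt (Icc_mem_nhds hx.1 hx.2))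
  refine (hd.const_add (f c)).congr_of_eventuallyEq ?_
  filter_upwards [hmem] with y hy using heq y (Ioo_subset_Icc_self hy)

/-- A function that dominates `1 / x` near `0` is not integrable. -/
lemma not_integrableOn_of_inv_le {f : ℝ → ℝ} {r : ℝ} (hr : 0 < r)
    (hf : ∀ᵐ x ∂(volume.restrict (Ioo 0 r)), x⁻¹ ≤ f x) : ¬ IntegrableOn f (Ioo 0 r) := by
  intro hint
  have h1 : IntegrableOn (fun x : ℝ => x⁻¹) (Ioo 0 r) := by
    refine Integrable.mono' hint measurable_inv.aestronglyMeasurable ?_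
    filter_upwards [hf, ae_restrict_mem measurableSet_Ioo] with x hx hx0
    rwa [Real.norm_of_nonneg (inv_nonneg.2 hx0.1.le)]
  rw [← intervalIntegrable_iff_integrableOn_Ioo_of_le hr.le, intervalIntegrable_inv_iff] at h1
  rcases h1 with h | h
  · exact hr.ne h
  · exact h left_mem_uIcc

lemma integrableOn_sq_of_memL2 {ℓ : ℝ} {f : ℝ → ℝ} (hf : MemL2 ℓ f) :
    IntegrableOn (fun x => f x ^ 2) (Ioo 0 ℓ) :=
  MemLp.integrable_sq hf

/-- A function that is continuous up to `0`, with `x^{-α/2} g ∈ L²` for some `α ≥ 1`, vanishes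
at `0`. -/
lemma eq_zero_of_memL2_rpow_mul {ℓ α : ℝ} {g f : ℝ → ℝ} (hℓ : 0 < ℓ) (hα : 1 ≤ α)
    (hg : ContinuousOn g (Icc 0 ℓ)) (hf : MemL2 ℓ f)
    (hfg : ∀ᵐ x ∂(volume.restrict (Ioo 0 ℓ)), f x ^ 2 = x ^ (-α) * g x ^ 2) : g 0 = 0 := by
  by_contra h0
  have hc : 0 < |g 0| := abs_pos.2 h0
  obtain ⟨r, hr, hball⟩ := Metric.continuousWithinAt_iff.1 (hg 0 ⟨le_rfl, hℓ.le⟩) (|g 0| / 2)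
    (by positivity)
  -- Staying below 1 gives x^{-α} ≥ x⁻¹, which is where α ≥ 1 is used.
  set s := min r (min 1 ℓ) with hs
  have hs0 : 0 < s := lt_min hr (lt_min one_pos hℓ)
  have hsr : s ≤ r := min_le_left _ _
  have hs1 : s ≤ 1 := (min_le_right _ _).trans (min_le_left _ _)
  have hsℓ : s ≤ ℓ := (min_le_right _ _).trans (min_le_right _ _)
  refine not_integrableOn_of_inv_le (f := fun x => 4 / |g 0| ^ 2 * f x ^ 2) hs0 ?_
    (((integrableOn_sq_of_memL2 hf).mono_set (Ioo_subset_Ioo_right hsℓ)).const_mul _)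
  filter_upwards [ae_restrict_of_ae_restrict_of_subset (Ioo_subset_Ioo_right hsℓ) hfg,
    ae_restrict_mem measurableSet_Ioo] with x hx hxs
  rw [hx]
  have hgx : |g 0| / 2 ≤ |g x| := by
    have := hball (x := x) ⟨hxs.1.le, (hxs.2.trans_le hsℓ).le⟩
      (by rw [Real.dist_eq, sub_zero, abs_of_pos hxs.1]; exact hxs.2.trans_le hsr)
    rw [Real.dist_eq, abs_sub_comm] at this
    have := (abs_sub_abs_le_abs_sub (g 0) (g x)).trans this.le
    linarith
  have hinv : x⁻¹ ≤ x ^ (-α) := by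
    rw [← Real.rpow_neg_one]
    exact Real.rpow_le_rpow_of_exponent_ge hxs.1 (hxs.2.le.trans hs1) (by linarith)
  have hA := Real.rpow_nonneg hxs.1.le (-α)
  have hsq : (|g 0| / 2) ^ 2 ≤ g x ^ 2 := by
    rw [← sq_abs (g x)]
    exact pow_le_pow_left₀ (by positivity) hgx 2
  calc x⁻¹ ≤ x ^ (-α) := hinv
    _ = 4 / |g 0| ^ 2 * (x ^ (-α) * (|g 0| / 2) ^ 2) := by field_simp; norm_num
    _ ≤ 4 / |g 0| ^ 2 * (x ^ (-α) * g x ^ 2) := by gcongr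

/-- If `u ∈ L²(0, ℓ)`, `p' = -μ u` and `p(0) = 0`, then `p u` has nonnegative upper limit at `0`. -/
lemma fluxProductLimsupNonneg_of_memL2 {ℓ μ : ℝ} {u p : ℝ → ℝ} (hℓ : 0 < ℓ) (hu : MemL2 ℓ u)
    (hpc : ContinuousOn p (Icc 0 ℓ)) (hp0 : p 0 = 0)
    (hp : ∀ x ∈ Ioo 0 ℓ, HasDerivAt p (-(μ * u x)) x) : FluxProductLimsupNonneg u p := by
  intro δ hδ r hr
  by_contra! hcon
  set S := ∫ x in Ioo 0 ℓ, u x ^ 2 with hS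
  have hS0 : 0 ≤ S := integral_nonneg fun _ => sq_nonneg _
  have hsq := integrableOn_sq_of_memL2 hu
  have hui : IntegrableOn u (Ioo 0 ℓ) := MemLp.integrable (by norm_num) hu
  have hbound : ∀ x ∈ Ioo 0 ℓ, |p x| ≤ |μ| * (√x * ((1 + S) / 2)) := by
    intro x hx
    have hsub : Ioo 0 x ⊆ Ioo 0 ℓ := Ioo_subset_Ioo_right hx.2.le
    have huix : IntervalIntegrable u volume 0 x :=
      (intervalIntegrable_iff_integrableOn_Ioo_of_le hx.1.le).2 (hui.mono_set hsub)
    have hftc := intervalIntegral.integral_eq_sub_of_hasDerivAt_of_le hx.1.le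
      (hpc.mono (Icc_subset_Icc_right hx.2.le))
      (fun y hy => hp y (hsub hy)) (huix.const_mul μ).neg
    rw [hp0, sub_zero] at hftc
    rw [← hftc]
    simp only [intervalIntegral.integral_neg, intervalIntegral.integral_const_mul, abs_neg, abs_mul]
    refine mul_le_mul_of_nonneg_left ?_ (abs_nonneg _)
    have hx0 := hx.1
    have hsqrt : 0 < √x := Real.sqrt_pos.2 hx0
    have hsqi : IntervalIntegrable (fun y => u y ^ 2) volume 0 x :=
      (intervalIntegrable_iff_integrableOn_Ioo_of_le hx.1.le).2 (hsq.mono_set hsub)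
    -- Cauchy–Schwarz in additive form: |u| ≤ 1/(2√x) + (√x/2) u², with x fixed, integrates to at
    -- most √x (1 + S)/2.
    have hle : |∫ y in (0 : ℝ)..x, u y| ≤ ∫ y in (0 : ℝ)..x, (1 / (2 * √x) + √x / 2 * u y ^ 2) := by
      refine intervalIntegral.abs_integral_le_integral_abs hx.1.le |>.trans ?_
      refine intervalIntegral.integral_mono_on hx.1.le huix.abs
        (intervalIntegrable_const.add (hsqi.const_mul _)) fun y _ => ?_
      rw [← sq_abs (u y)]
      have e : 1 / (2 * √x) + √x / 2 * |u y| ^ 2 - |u y| =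
          (√x * |u y| - 1) ^ 2 / (2 * √x) := by field_simp; ring
      have : 0 ≤ (√x * |u y| - 1) ^ 2 / (2 * √x) := by positivity
      linarith
    rw [intervalIntegral.integral_add intervalIntegrable_const (hsqi.const_mul _),
      intervalIntegral.integral_const, intervalIntegral.integral_const_mul] at hle
    have hle2 : ∫ y in (0 : ℝ)..x, u y ^ 2 ≤ S := by
      rw [intervalIntegral.integral_of_le hx.1.le, integral_Ioc_eq_integral_Ioo]
      exact setIntegral_mono_set hsq (Filter.Eventually.of_forall fun _ => sq_nonneg _)
        hsub.eventuallyLE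
    have hxx : (x - 0) • (1 / (2 * √x)) = √x / 2 := by
      rw [sub_zero, smul_eq_mul]
      field_simp
      rw [Real.sq_sqrt hx0.le]
    rw [hxx] at hle
    nlinarith
  set s := min r ℓ with hs
  have hs0 : 0 < s := lt_min hr hℓ
  have hsℓ : s ≤ ℓ := min_le_right _ _
  refine not_integrableOn_of_inv_le
    (f := fun x => (|μ| * ((1 + S) / 2)) ^ 2 / δ ^ 2 * u x ^ 2) hs0 ?_
    ((hsq.mono_set (Ioo_subset_Ioo_right hsℓ)).const_mul _)
  filter_upwards [ae_restrict_mem measurableSet_Ioo] with x hx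
  have hx0 := hx.1
  have h1 := hcon x hx.1 (hx.2.trans_le (min_le_left _ _))
  have h2 := hbound x ⟨hx.1, hx.2.trans_le hsℓ⟩
  have h3 : δ ≤ |μ| * (√x * ((1 + S) / 2)) * |u x| := by
    have : δ ≤ |p x| * |u x| := by
      rw [← abs_mul]
      have := neg_le_abs (p x * u x)
      linarith
    exact this.trans (mul_le_mul_of_nonneg_right h2 (abs_nonneg _))
  have h4 := pow_le_pow_left₀ hδ.le h3 2
  have e : (|μ| * (√x * ((1 + S) / 2)) * |u x|) ^ 2 =
      x * ((|μ| * ((1 + S) / 2)) ^ 2 * u x ^ 2) := by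
    rw [← sq_abs (u x), ← Real.sq_sqrt hx0.le, Real.sqrt_sq (Real.sqrt_nonneg x)]
    ring
  rw [e] at h4
  rw [div_mul_eq_mul_div, le_div_iff₀ (by positivity), inv_mul_le_iff₀ hx0]
  exact h4

/-- An eigenfunction solves the first order system classically. -/
lemma IsNormalizedEigenfunction.exists_isFluxSolution {ℓ α μ : ℝ} {u : ℝ → ℝ} (hℓ : 0 < ℓ)
    (hα : 1 ≤ α) (h : IsNormalizedEigenfunction ℓ α μ u) :
    ∃ p, IsFluxSolution ℓ α μ u p ∧ FluxProductLimsupNonneg u p := by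
  obtain ⟨⟨⟨⟨hu2, huac, hflux2⟩, hbc⟩, -, -, g, hgac, hgflux, hgd⟩, -⟩ := h
  have hgc : ContinuousOn g (Icc 0 ℓ) := by
    have := hgac.continuousOn
    rwa [uIcc_of_le hℓ.le] at this
  have huc : ContinuousOn u (Ioc 0 ℓ) := by
    intro x hx
    have hc := (huac (x / 2) (by linarith [hx.1]) (by linarith [hx.1, hx.2])).continuousOn
    rw [uIcc_of_le (by linarith [hx.1, hx.2])] at hc
    refine (hc x ⟨by linarith [hx.1], hx.2⟩).mono_of_mem_nhdsWithin ?_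
    filter_upwards [self_mem_nhdsWithin,
      mem_nhdsWithin_of_mem_nhds (lt_mem_nhds (half_lt_self hx.1))] with y hy hy'
    exact ⟨le_of_lt hy', hy.2⟩
  have hderiv : ∀ᵐ x ∂(volume.restrict (Ioo 0 ℓ)), deriv u x = x ^ (-α) * g x := by
    filter_upwards [hgflux, ae_restrict_mem measurableSet_Ioo] with x hx hx0
    rw [← hx, flux, ← mul_assoc, ← Real.rpow_add hx0.1]
    simp
  have hsub : ∀ x ∈ Ioo 0 ℓ, Ioo (x / 2) ℓ ⊆ Ioo 0 ℓ := fun x hx =>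
    Ioo_subset_Ioo_left (by linarith [hx.1])
  have hsub' : ∀ x ∈ Ioo 0 ℓ, Icc (x / 2) ℓ ⊆ Ioc 0 ℓ := fun x hx y hy =>
    ⟨by linarith [hx.1, hy.1], hy.2⟩
  have hp : ∀ x ∈ Ioo 0 ℓ, HasDerivAt g (-(μ * u x)) x := by
    intro x hx
    refine hasDerivAt_of_absolutelyContinuous (c := x / 2) (d := ℓ) (φ := fun y => -(μ * u y))
      (hgac.mono ?_) ?_ ?_ ⟨by linarith [hx.1], hx.2⟩
    · rw [uIcc_of_le hℓ.le, uIcc_of_le (by linarith [hx.1, hx.2])]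
      exact (hsub' x hx).trans Ioc_subset_Icc_self
    · exact (continuousOn_const.mul (huc.mono (hsub' x hx))).neg
    · filter_upwards [ae_restrict_of_ae_restrict_of_subset (hsub x hx) hgd] with y hy
      exact hy.deriv
  -- The absolutely continuous representative `g` plays the role of p, since the flux x^α u' equals
  -- it only almost everywhere at this stage.
  refine ⟨g, ⟨huc, hgc.mono Ioc_subset_Icc_self, fun x hx => ?_, hp, hbc⟩, ?_⟩
  · refine hasDerivAt_of_absolutelyContinuous (c := x / 2) (d := ℓ) (φ := fun y => y ^ (-α) * g y)
      (huac _ (by linarith [hx.1]) (by linarith [hx.1, hx.2])) ?_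
      (ae_restrict_of_ae_restrict_of_subset (hsub x hx) hderiv) ⟨by linarith [hx.1], hx.2⟩
    exact ((continuousOn_rpow_neg α ℓ).mul (hgc.mono Ioc_subset_Icc_self)).mono (hsub' x hx)
  · refine fluxProductLimsupNonneg_of_memL2 hℓ hu2 hgc ?_ hp
    refine eq_zero_of_memL2_rpow_mul hℓ hα hgc hflux2 ?_
    filter_upwards [hderiv, ae_restrict_mem measurableSet_Ioo] with x hx hx0
    have e : (x ^ (α / 2)) ^ 2 = x ^ α := by
      rw [← Real.rpow_natCast, ← Real.rpow_mul hx0.1.le]; norm_num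
    have e2 : x ^ α * x ^ (-α) = 1 := by rw [← Real.rpow_add hx0.1]; simp
    rw [hx, mul_pow, e]
    linear_combination (x ^ (-α) * g x ^ 2) * e2

/-- The lower bound for the mass in `(a, b)` of a normalized eigenfunction. -/
theorem IsNormalizedEigenfunction.mass_lower_bound {a b ℓ α μ : ℝ} {u : ℝ → ℝ} (ha : 0 < a)
    (hab : a < b) (hbℓ : b < ℓ) (hα1 : 1 ≤ α) (hα2 : α < 2)
    (h : IsNormalizedEigenfunction ℓ α μ u) :
    massConstant a b ℓ * (2 - α) ≤ ∫ x in a..b, u x ^ 2 := by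
  have hℓ : 0 < ℓ := ha.trans (hab.trans hbℓ)
  obtain ⟨p, hp, hlim⟩ := h.exists_isFluxSolution hℓ hα1
  have hnorm := h.2
  have hne : ∃ x ∈ Ioo 0 ℓ, u x ≠ 0 := by
    by_contra! h0
    have : ∫ x in (0 : ℝ)..ℓ, u x ^ 2 = 0 := by
      rw [intervalIntegral.integral_of_le hℓ.le, integral_Ioc_eq_integral_Ioo]
      exact setIntegral_eq_zero_of_forall_eq_zero fun x hx => by rw [h0 x hx]; norm_num
    rw [this] at hnorm
    exact zero_ne_one hnorm
  have hμ := hp.one_le_eigenvalue hα2 hlim hne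
  have hμ0 : 0 ≤ μ := by
    by_contra! hlt
    have : 4 * ℓ ^ (2 - α) * μ ≤ 0 := mul_nonpos_of_nonneg_of_nonpos (by positivity) hlt.le
    linarith
  have hE := hp.le_energyDensity_boundary hα1 hℓ hμ0 hlim
    ((intervalIntegrable_iff_integrableOn_Ioo_of_le hℓ.le).2
      (integrableOn_sq_of_memL2 h.1.1.1.1))
  rw [hnorm, mul_one] at hE
  exact hp.mass_lower_bound ha hab hbℓ hα1 hα2 hμ hE

/-! ### The power series of J_ν -/

/-- The entire function `∑ (-z)^m / (m! Γ(m + ν + 1))`, so that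
`J_ν(y) = (y/2)^ν besselEntire ν (y²/4)`. -/
noncomputable def besselEntire (ν z : ℝ) : ℝ :=
  ∑' m : ℕ, (-z) ^ m / ((m.factorial : ℝ) * Real.Gamma (m + ν + 1))

/-- Each step of the functional equation multiplies by a factor at least 1. The series is thereby
dominated by an exponential series. -/
lemma gamma_le_gamma_nat_add {ν : ℝ} (hν : 0 ≤ ν) (m : ℕ) :
    Real.Gamma (ν + 1) ≤ Real.Gamma (m + ν + 1) := by
  induction m with
  | zero => simp
  | succ m ih =>
    have e : ((m + 1 : ℕ) : ℝ) + ν + 1 = (m + ν + 1) + 1 := by push_cast; ring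
    have hpos : (0 : ℝ) < m + ν + 1 := by positivity
    rw [e, Real.Gamma_add_one hpos.ne']
    have := Real.Gamma_pos_of_pos hpos
    have h1 : (1 : ℝ) ≤ m + ν + 1 := by
      have : (0 : ℝ) ≤ m := Nat.cast_nonneg m
      linarith
    nlinarith

lemma norm_besselEntire_term_le {ν : ℝ} (hν : 0 ≤ ν) (m k : ℕ) {z R : ℝ} (hz : |z| ≤ R) :
    ‖(-z) ^ k / ((k.factorial : ℝ) * Real.Gamma (m + ν + 1))‖ ≤
      R ^ k / k.factorial * (Real.Gamma (ν + 1))⁻¹ := by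
  have hΓ : 0 < Real.Gamma (ν + 1) := Real.Gamma_pos_of_pos (by linarith)
  have hle := gamma_le_gamma_nat_add hν m
  have hΓm := hΓ.trans_le hle
  rw [norm_div, norm_pow, norm_neg, Real.norm_eq_abs, norm_mul, Real.norm_of_nonneg hΓm.le,
    Real.norm_of_nonneg (by positivity), ← div_div, ← div_eq_mul_inv]
  have hR : 0 ≤ R := (abs_nonneg z).trans hz
  gcongr

lemma summable_besselEntire {ν : ℝ} (hν : 0 ≤ ν) (z : ℝ) :
    Summable fun m : ℕ => (-z) ^ m / ((m.factorial : ℝ) * Real.Gamma (m + ν + 1)) :=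
  .of_norm_bounded ((Real.summable_pow_div_factorial |z|).mul_right _)
    fun m => norm_besselEntire_term_le hν m m le_rfl

lemma besselEntire_zero_pos {ν : ℝ} (hν : 0 ≤ ν) : 0 < besselEntire ν 0 := by
  have : besselEntire ν 0 = 1 / Real.Gamma (ν + 1) := by
    rw [besselEntire, tsum_eq_single 0 fun m hm => by simp [hm]]
    simp
  rw [this]
  exact one_div_pos.2 (Real.Gamma_pos_of_pos (by linarith))

lemma hasDerivAt_besselEntire {ν : ℝ} (hν : 0 ≤ ν) (z : ℝ) :
    HasDerivAt (besselEntire ν) (-besselEntire (ν + 1) z) z := by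
  set g' : ℕ → ℝ → ℝ := fun n y =>
    (n : ℝ) * (-y) ^ (n - 1) * (-1) / ((n.factorial : ℝ) * Real.Gamma (n + ν + 1)) with hg'
  have hshift : ∀ (n : ℕ) (y : ℝ), g' (n + 1) y =
      -((-y) ^ n / ((n.factorial : ℝ) * Real.Gamma (n + (ν + 1) + 1))) := by
    intro n y
    have e : ((n + 1 : ℕ) : ℝ) + ν + 1 = n + (ν + 1) + 1 := by push_cast; ring
    have hn : ((n : ℝ) + 1) ≠ 0 := by positivity
    simp only [hg', e, Nat.add_sub_cancel, Nat.factorial_succ]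
    push_cast
    have hf : (n.factorial : ℝ) ≠ 0 := by positivity
    have hΓ : Real.Gamma (n + (ν + 1) + 1) ≠ 0 := (Real.Gamma_pos_of_pos (by positivity)).ne'
    field_simp
  set R := |z| + 1 with hR
  -- The case n = 0 is separate because n - 1 truncates there, while the derivative of the constant
  -- term is 0.
  set b : ℕ → ℝ := fun n => if n = 0 then 0 else
    R ^ (n - 1) / (n - 1).factorial * (Real.Gamma (ν + 1 + 1))⁻¹ with hb
  have hbs : Summable b := by
    rw [← summable_nat_add_iff 1]
    simpa [hb] using (Real.summable_pow_div_factorial R).mul_right (Real.Gamma (ν + 1 + 1))⁻¹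
  have hmain := hasDerivAt_tsum_of_isPreconnected (y₀ := z) (y := z)
    (g := fun (n : ℕ) y => (-y) ^ n / ((n.factorial : ℝ) * Real.Gamma (n + ν + 1))) (g' := g')
    (t := Metric.ball 0 R) hbs Metric.isOpen_ball (convex_ball 0 R).isPreconnected
    (fun n y _ => ?_) (fun n y hy => ?_) (by simp [hR]) (summable_besselEntire hν z) (by simp [hR])
  · refine hmain.congr_deriv ?_
    have hs : Summable fun n => g' n z := by
      rw [← summable_nat_add_iff 1]
      simp only [hshift]
      exact (summable_besselEntire (by linarith) z).neg
    rw [hs.tsum_eq_zero_add]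
    simp only [hshift, tsum_neg]
    simp [hg', besselEntire]
  · exact (((hasDerivAt_id y).neg.pow n).div_const _).congr_deriv (by simp [hg'])
  · have hyR : |y| ≤ R := by
      have := Metric.mem_ball.1 hy
      rw [Real.dist_eq, sub_zero] at this
      exact this.le
    cases n with
    | zero => simp [hg', hb]
    | succ n =>
      rw [hshift, norm_neg]
      simpa [hb] using norm_besselEntire_term_le (ν := ν + 1) (by linarith) n n hyR

lemma continuous_besselEntire {ν : ℝ} (hν : 0 ≤ ν) : Continuous (besselEntire ν) :=
  continuous_iff_continuousAt.2 fun z => (hasDerivAt_besselEntire hν z).continuousAt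

/-- The three term recurrence. -/
lemma besselEntire_recurrence {ν : ℝ} (hν : 0 ≤ ν) (z : ℝ) :
    besselEntire ν z = (ν + 1) * besselEntire (ν + 1) z - z * besselEntire (ν + 1 + 1) z := by
  have hs0 := summable_besselEntire hν z
  have hs1 := summable_besselEntire (ν := ν + 1) (by linarith) z
  have hs2 := summable_besselEntire (ν := ν + 1 + 1) (by linarith) z
  -- By Γ(m+ν+2) = (m+ν+1) Γ(m+ν+1) the difference carries a factor m: the term m = 0 drops out, and
  -- after an index shift m + 1 cancels in the factorial.
  have hterm : ∀ m : ℕ, (-z) ^ m / ((m.factorial : ℝ) * Real.Gamma (m + ν + 1)) -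
      (ν + 1) * ((-z) ^ m / ((m.factorial : ℝ) * Real.Gamma (m + (ν + 1) + 1))) =
      m * ((-z) ^ m / ((m.factorial : ℝ) * Real.Gamma (m + (ν + 1) + 1))) := by
    intro m
    have hpos : (0 : ℝ) < m + ν + 1 := by positivity
    have e : (m : ℝ) + (ν + 1) + 1 = (m + ν + 1) + 1 := by ring
    have hf : (m.factorial : ℝ) ≠ 0 := by positivity
    have hΓ := (Real.Gamma_pos_of_pos hpos).ne'
    have hp := hpos.ne'
    rw [e, Real.Gamma_add_one hp]
    field_simp
    ring
  have hdiff := hs0.sub (hs1.mul_left (ν + 1))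
  have h1 : besselEntire ν z - (ν + 1) * besselEntire (ν + 1) z =
      -(z * besselEntire (ν + 1 + 1) z) := by
    unfold besselEntire
    rw [← tsum_mul_left, ← hs0.tsum_sub (hs1.mul_left (ν + 1)), hdiff.tsum_eq_zero_add, hterm,
      ← tsum_mul_left, ← tsum_neg]
    simp only [hterm]
    rw [Nat.cast_zero, zero_mul, zero_add]
    refine tsum_congr fun m => ?_
    have e : ((m + 1 : ℕ) : ℝ) + (ν + 1) + 1 = m + (ν + 1 + 1) + 1 := by push_cast; ring
    have hf : (m.factorial : ℝ) ≠ 0 := by positivity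
    have hm : ((m : ℝ) + 1) ≠ 0 := by positivity
    have hΓ : Real.Gamma (m + (ν + 1 + 1) + 1) ≠ 0 := (Real.Gamma_pos_of_pos (by positivity)).ne'
    rw [e, Nat.factorial_succ]
    push_cast
    field_simp
    ring
  linarith

lemma besselJ_eq {ν y : ℝ} (hy : 0 < y) :
    besselJ ν y = (y / 2) ^ ν * besselEntire ν (y ^ 2 / 4) := by
  unfold besselJ besselEntire
  rw [← tsum_mul_left]
  refine tsum_congr fun m => ?_
  have e : (y / 2) ^ (2 * (m : ℝ) + ν) = (y ^ 2 / 4) ^ m * (y / 2) ^ ν := by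
    rw [Real.rpow_add (by positivity), Real.rpow_mul (by positivity), Real.rpow_natCast]
    congr 2
    norm_num
    ring
  rw [e, neg_pow (y ^ 2 / 4) m]
  ring

/-! ### Oscillation -/

/-- Sturm comparison with `sin (x / 2)`. -/
lemma not_pos_of_sturm {w w' Q : ℝ → ℝ} {Y : ℝ}
    (hw : ∀ x ∈ Icc Y (Y + 2 * Real.pi), HasDerivAt w (w' x) x)
    (hw' : ∀ x ∈ Icc Y (Y + 2 * Real.pi), HasDerivAt w' (-(Q x * w x)) x)
    (hQ : ∀ x ∈ Icc Y (Y + 2 * Real.pi), 1 / 4 ≤ Q x) :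
    ¬ ∀ x ∈ Icc Y (Y + 2 * Real.pi), 0 < w x := by
  intro hpos
  have hπ := Real.pi_pos
  -- The Wronskian with sin((x-Y)/2). If w > 0 it is nonincreasing, yet its values at the two ends
  -- are -w(Y)/2 < 0 and w(Y+2π)/2 > 0.
  set W : ℝ → ℝ := fun x =>
    w' x * Real.sin ((x - Y) / 2) - w x * (Real.cos ((x - Y) / 2) / 2) with hW
  have hd : ∀ x ∈ Icc Y (Y + 2 * Real.pi),
      HasDerivAt W ((1 / 4 - Q x) * w x * Real.sin ((x - Y) / 2)) x := by
    intro x hx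
    have hl : HasDerivAt (fun y : ℝ => (y - Y) / 2) (1 / 2) x :=
      ((hasDerivAt_id x).sub_const Y).div_const 2
    refine (((hw' x hx).mul hl.sin).sub ((hw x hx).mul (hl.cos.div_const 2))).congr_deriv ?_
    ring
  have hanti : AntitoneOn W (Icc Y (Y + 2 * Real.pi)) := by
    refine antitoneOn_of_deriv_nonpos (convex_Icc _ _)
      (fun x hx => (hd x hx).continuousAt.continuousWithinAt) ?_ ?_ <;> rw [interior_Icc]
    · exact fun x hx => (hd x (Ioo_subset_Icc_self hx)).differentiableAt.differentiableWithinAt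
    · intro x hx
      have hx' := Ioo_subset_Icc_self hx
      rw [(hd x hx').deriv]
      have hs : 0 ≤ Real.sin ((x - Y) / 2) :=
        Real.sin_nonneg_of_nonneg_of_le_pi (by linarith [hx.1]) (by linarith [hx.2])
      exact mul_nonpos_of_nonpos_of_nonneg
        (mul_nonpos_of_nonpos_of_nonneg (by linarith [hQ x hx']) (hpos x hx').le) hs
  have hl : Y ∈ Icc Y (Y + 2 * Real.pi) := ⟨le_rfl, by linarith⟩
  have hr : Y + 2 * Real.pi ∈ Icc Y (Y + 2 * Real.pi) := ⟨by linarith, le_rfl⟩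
  have h := hanti hl hr hl.2
  have e : (Y + 2 * Real.pi - Y) / 2 = Real.pi := by ring
  simp only [hW, e, sub_self, zero_div, Real.sin_zero, Real.cos_zero, Real.sin_pi,
    Real.cos_pi] at h
  linarith [hpos _ hl, hpos _ hr]

lemma exists_zero_of_sturm {w w' Q : ℝ → ℝ} {Y : ℝ}
    (hw : ∀ x ∈ Icc Y (Y + 2 * Real.pi), HasDerivAt w (w' x) x)
    (hw' : ∀ x ∈ Icc Y (Y + 2 * Real.pi), HasDerivAt w' (-(Q x * w x)) x)
    (hQ : ∀ x ∈ Icc Y (Y + 2 * Real.pi), 1 / 4 ≤ Q x) :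
    ∃ x ∈ Icc Y (Y + 2 * Real.pi), w x = 0 := by
  have h1 := not_pos_of_sturm hw hw' hQ
  have h2 := not_pos_of_sturm (w := fun x => -w x) (w' := fun x => -w' x) (Q := Q)
    (fun x hx => (hw x hx).neg)
    (fun x hx => (hw' x hx).neg.congr_deriv (by ring)) hQ
  push Not at h1 h2
  obtain ⟨x, hx, hwx⟩ := h1
  obtain ⟨y, hy, hwy⟩ := h2
  have hc : ContinuousOn w (Icc Y (Y + 2 * Real.pi)) :=
    fun x hx => (hw x hx).continuousAt.continuousWithinAt
  exact isPreconnected_Icc.intermediate_value hx hy hc ⟨hwx, by linarith⟩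

lemma hasDerivAt_besselEntire_sq {ν : ℝ} (hν : 0 ≤ ν) (y : ℝ) :
    HasDerivAt (fun t => besselEntire ν (t ^ 2 / 4))
      (-(y / 2 * besselEntire (ν + 1) (y ^ 2 / 4))) y := by
  have h1 : HasDerivAt (fun t : ℝ => t ^ 2 / 4) (y / 2) y :=
    ((hasDerivAt_pow 2 y).div_const 4).congr_deriv (by push_cast; ring)
  exact ((hasDerivAt_besselEntire hν _).comp y h1).congr_deriv (by ring)

/-- `J_ν` has arbitrarily large zeros. -/
lemma exists_besselEntire_sq_eq_zero {ν : ℝ} (hν : 0 ≤ ν) (Y : ℝ) :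
    ∃ y, Y < y ∧ 0 < y ∧ besselEntire ν (y ^ 2 / 4) = 0 := by
  -- Beyond 2ν+1 the potential 1 - (ν²-1/4)/x² is at least 1/4.
  set Z := max (Y + 1) (2 * ν + 1) with hZ
  have hZ0 : 0 < Z := lt_max_of_lt_right (by linarith)
  set f : ℝ → ℝ := fun t => besselEntire ν (t ^ 2 / 4) with hf
  set f' : ℝ → ℝ := fun t => -(t / 2 * besselEntire (ν + 1) (t ^ 2 / 4)) with hf'
  -- The product P f is 2^ν √t J_ν(t), the Liouville normal form w'' + (1 - (ν²-1/4)/t²) w = 0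
  -- without a first order term.
  set P : ℝ → ℝ := fun t => t ^ (ν + 1 / 2) with hP
  have hPd : ∀ x : ℝ, 0 < x → HasDerivAt P ((ν + 1 / 2) * (P x / x)) x := by
    intro x hx
    have h := Real.hasDerivAt_rpow_const (x := x) (p := ν + 1 / 2) (Or.inl hx.ne')
    rwa [Real.rpow_sub_one hx.ne'] at h
  have hf'd : ∀ x : ℝ, 0 < x → HasDerivAt f' (-((2 * ν + 1) * f' x / x) - f x) x := by
    intro x hx
    have h := (((hasDerivAt_id x).div_const 2).mul
      (hasDerivAt_besselEntire_sq (ν := ν + 1) (by linarith) x)).neg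
    refine h.congr_deriv ?_
    simp only [hf, hf', id]
    rw [besselEntire_recurrence hν]
    field_simp
    ring
  set w' : ℝ → ℝ := fun x => (ν + 1 / 2) * (P x / x) * f x + P x * f' x with hw'
  have hw'd : ∀ x : ℝ, 0 < x →
      HasDerivAt w' (-((1 - (ν ^ 2 - 1 / 4) / x ^ 2) * (P x * f x))) x := by
    intro x hx
    have h := (((((hPd x hx).div (hasDerivAt_id x) hx.ne').const_mul (ν + 1 / 2)).mul
      (hasDerivAt_besselEntire_sq hν x))).add ((hPd x hx).mul (hf'd x hx))
    refine h.congr_deriv ?_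
    have hx' := hx.ne'
    simp only [id, hf, hf', Pi.div_apply]
    field_simp
    ring
  have hQ : ∀ x ∈ Icc Z (Z + 2 * Real.pi), 1 / 4 ≤ 1 - (ν ^ 2 - 1 / 4) / x ^ 2 := by
    intro x hx
    have hx0 : 0 < x := hZ0.trans_le hx.1
    have hxν : 2 * ν + 1 ≤ x := (le_max_right (Y + 1) (2 * ν + 1)).trans hx.1
    have : (ν ^ 2 - 1 / 4) / x ^ 2 ≤ 3 / 4 := by
      rw [div_le_iff₀ (by positivity)]
      nlinarith
    linarith
  obtain ⟨y, hy, hy0⟩ := exists_zero_of_sturm (w := fun x => P x * f x)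
    (fun x hx => (hPd x (hZ0.trans_le hx.1)).mul (hasDerivAt_besselEntire_sq hν x))
    (fun x hx => hw'd x (hZ0.trans_le hx.1)) hQ
  have hyZ : 0 < y := hZ0.trans_le hy.1
  have hPy : P y ≠ 0 := (Real.rpow_pos_of_pos hyZ _).ne'
  refine ⟨y, ?_, hyZ, (mul_eq_zero.1 hy0).resolve_left hPy⟩
  have := (le_max_left (Y + 1) (2 * ν + 1)).trans hy.1
  linarith

/-- The infimum lies in the closed zero set of the entire factor, and stays away from 0 because that
factor is positive at 0. Strict growth of the sequence of zeros is not needed. -/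
lemma besselZero_succ_spec {ν : ℝ} (hν : 0 ≤ ν) {n : ℕ} (hn : 0 ≤ besselZero ν n) :
    0 < besselZero ν (n + 1) ∧ besselEntire ν (besselZero ν (n + 1) ^ 2 / 4) = 0 := by
  have hc : Continuous fun y : ℝ => besselEntire ν (y ^ 2 / 4) :=
    (continuous_besselEntire hν).comp (by fun_prop)
  set S := {y : ℝ | besselZero ν n < y ∧ besselJ ν y = 0} with hS
  have hSF : ∀ y ∈ S, besselEntire ν (y ^ 2 / 4) = 0 := by
    intro y hy
    have hy0 : 0 < y := hn.trans_lt hy.1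
    have h := hy.2
    rw [besselJ_eq hy0] at h
    exact (mul_eq_zero.1 h).resolve_left (Real.rpow_pos_of_pos (by positivity) _).ne'
  have hne : S.Nonempty := by
    obtain ⟨y, hy, hy0, h⟩ := exists_besselEntire_sq_eq_zero hν (besselZero ν n)
    exact ⟨y, hy, by rw [besselJ_eq hy0, h, mul_zero]⟩
  have hbdd : BddBelow S := ⟨besselZero ν n, fun y hy => hy.1.le⟩
  obtain ⟨δ, hδ, hball⟩ := Metric.eventually_nhds_iff.1
    ((hc.tendsto 0).eventually_ne (by simpa using (besselEntire_zero_pos hν).ne' :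
      besselEntire ν ((0 : ℝ) ^ 2 / 4) ≠ 0))
  have hz : besselZero ν (n + 1) = sInf S := rfl
  rw [hz]
  constructor
  · refine hδ.trans_le (le_csInf hne fun y hy => ?_)
    by_contra! hlt
    refine hball (y := y) ?_ (hSF y hy)
    rwa [Real.dist_eq, sub_zero, abs_of_pos (hn.trans_lt hy.1)]
  · exact closure_minimal hSF (isClosed_eq hc continuous_const) (csInf_mem_closure hne hbdd)

lemma besselZero_nonneg {ν : ℝ} (hν : 0 ≤ ν) (n : ℕ) : 0 ≤ besselZero ν n := by
  induction n with
  | zero => exact le_rfl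
  | succ n ih => exact (besselZero_succ_spec hν ih).1.le

/-! ### The explicit eigenfunctions -/

lemma IsFluxSolution.const_mul {ℓ α μ : ℝ} {u p : ℝ → ℝ} (h : IsFluxSolution ℓ α μ u p) (K : ℝ) :
    IsFluxSolution ℓ α μ (fun x => K * u x) (fun x => K * p x) where
  continuousOn_left := continuousOn_const.mul h.continuousOn_left
  continuousOn_right := continuousOn_const.mul h.continuousOn_right
  hasDerivAt_left x hx := ((h.hasDerivAt_left x hx).const_mul K).congr_deriv (by ring)
  hasDerivAt_right x hx := ((h.hasDerivAt_right x hx).const_mul K).congr_deriv (by ring)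
  boundary := by rw [h.boundary, mul_zero]

lemma nuIndex_nonneg {α : ℝ} (hα1 : 1 ≤ α) (hα2 : α < 2) : 0 ≤ nuIndex α :=
  div_nonneg (by linarith) (by linarith)

/-- This relation turns the three term recurrence into p' = -μ u for the explicit solution. -/
lemma nuIndex_add_one {α : ℝ} (hα2 : α < 2) : (2 - α) * (nuIndex α + 1) = 1 := by
  have : 2 - α ≠ 0 := by linarith
  unfold nuIndex
  field_simp
  ring

lemma continuous_besselEntire_rpow {α ν c : ℝ} (hν : 0 ≤ ν) (hα2 : α < 2) :
    Continuous fun x : ℝ => besselEntire ν (c * x ^ (2 - α)) :=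
  (continuous_besselEntire hν).comp
    (continuous_const.mul (Real.continuous_rpow_const (by linarith)))

lemma hasDerivAt_besselEntire_rpow {α ν c x : ℝ} (hν : 0 ≤ ν) (hx : 0 < x) :
    HasDerivAt (fun t : ℝ => besselEntire ν (c * t ^ (2 - α)))
      (-(besselEntire (ν + 1) (c * x ^ (2 - α)) * (c * ((2 - α) * (x ^ (2 - α) / x))))) x := by
  have h := Real.hasDerivAt_rpow_const (x := x) (p := 2 - α) (Or.inl hx.ne')
  rw [Real.rpow_sub_one hx.ne'] at h
  exact ((hasDerivAt_besselEntire hν _).comp x (h.const_mul c)).congr_deriv (by ring)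

/-- `x ↦ besselEntire ν_α (c x^{2-α})` solves the eigenvalue equation for `μ = (2-α)² c`. -/
lemma isFluxSolution_besselEntire {ℓ α c : ℝ} (hα1 : 1 ≤ α) (hα2 : α < 2)
    (hc : besselEntire (nuIndex α) (c * ℓ ^ (2 - α)) = 0) :
    IsFluxSolution ℓ α ((2 - α) ^ 2 * c) (fun x => besselEntire (nuIndex α) (c * x ^ (2 - α)))
      (fun x => -(c * (2 - α) * (x * besselEntire (nuIndex α + 1) (c * x ^ (2 - α))))) := by
  have hν := nuIndex_nonneg hα1 hα2
  have hν1 : 0 ≤ nuIndex α + 1 := by linarith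
  refine ⟨(continuous_besselEntire_rpow hν hα2).continuousOn,
    (continuous_const.mul (continuous_id.mul
      (continuous_besselEntire_rpow hν1 hα2))).neg.continuousOn, fun x hx => ?_, fun x hx => ?_, hc⟩
  · refine (hasDerivAt_besselEntire_rpow hν hx.1).congr_deriv ?_
    have e : x ^ (2 - α) = x ^ 2 * x ^ (-α) := by
      rw [sub_eq_add_neg, Real.rpow_add hx.1]; norm_num
    have hx0 := hx.1.ne'
    generalize besselEntire (nuIndex α + 1) (c * x ^ (2 - α)) = F
    rw [e]
    field_simp
  · have h := (((hasDerivAt_id x).mul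
      (hasDerivAt_besselEntire_rpow (α := α) (c := c) hν1 hx.1)).const_mul (c * (2 - α))).neg
    refine h.congr_deriv ?_
    have hx0 := hx.1.ne'
    simp only [id]
    rw [besselEntire_recurrence hν]
    generalize besselEntire (nuIndex α + 1) (c * x ^ (2 - α)) = F
    generalize besselEntire (nuIndex α + 1 + 1) (c * x ^ (2 - α)) = G
    field_simp
    linear_combination ((2 - α) * c * F) * (nuIndex_add_one hα2)

lemma fluxProductLimsupNonneg_of_continuous {u p : ℝ → ℝ} (hu : Continuous u) (hp : Continuous p)
    (hp0 : p 0 = 0) : FluxProductLimsupNonneg u p := by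
  intro δ hδ r hr
  obtain ⟨s, hs, hball⟩ := Metric.continuousAt_iff.1 ((hp.mul hu).continuousAt (x := 0)) δ hδ
  have hm : 0 < min s r := lt_min hs hr
  have h := hball (x := min s r / 2) (by
    rw [Real.dist_eq, sub_zero, abs_of_pos (by positivity)]
    linarith [min_le_left s r])
  simp only [Pi.mul_apply, hp0, zero_mul, Real.dist_eq, sub_zero] at h
  exact ⟨min s r / 2, by positivity, by linarith [min_le_right s r], (abs_lt.1 h).1.le⟩

lemma deriv_besselJ_of_zero {ν j : ℝ} (hν : 0 ≤ ν) (hj : 0 < j)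
    (h0 : besselEntire ν (j ^ 2 / 4) = 0) :
    deriv (besselJ ν) j = -((j / 2) ^ ν * (j / 2 * besselEntire (ν + 1) (j ^ 2 / 4))) := by
  have h1 : HasDerivAt (fun y : ℝ => (y / 2) ^ ν) (1 / 2 * ν * (j / 2) ^ (ν - 1)) j :=
    ((hasDerivAt_id j).div_const 2).rpow_const (Or.inl (by simp [hj.ne']))
  have h2 := h1.mul (hasDerivAt_besselEntire_sq hν j)
  rw [h0] at h2
  have h3 : HasDerivAt (besselJ ν) _ j := h2.congr_of_eventuallyEq (by
    filter_upwards [lt_mem_nhds hj] with y hy using besselJ_eq hy)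
  rw [h3.deriv]
  ring

/-- The factor between `Φ_{α,m}` and `besselEntire ν_α (c x^{2-α})`. -/
noncomputable def eigenPhiFactor (ℓ α j : ℝ) : ℝ :=
  Real.sqrt (2 * kappa α) / (ℓ ^ kappa α * |deriv (besselJ (nuIndex α)) j|) *
    ((j / 2) ^ nuIndex α / ℓ ^ ((α - 1) / 2))

lemma kappa_mul_nuIndex {α : ℝ} (hα2 : α < 2) : kappa α * nuIndex α = (α - 1) / 2 := by
  have : 2 - α ≠ 0 := by linarith
  unfold kappa nuIndex
  field_simp

lemma eigenPhi_eq {ℓ α x : ℝ} {m : ℕ} (hℓ : 0 < ℓ) (hα2 : α < 2) (hx : 0 < x)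
    (hj : 0 < besselZero (nuIndex α) m) :
    eigenPhi ℓ α m x = eigenPhiFactor ℓ α (besselZero (nuIndex α) m) *
      besselEntire (nuIndex α)
        (besselZero (nuIndex α) m ^ 2 / 4 * ℓ ^ (α - 2) * x ^ (2 - α)) := by
  unfold eigenPhi eigenPhiFactor
  set j := besselZero (nuIndex α) m
  have hxl : 0 < x / ℓ := div_pos hx hℓ
  have e1 : (j * (x / ℓ) ^ kappa α) ^ 2 / 4 = j ^ 2 / 4 * ℓ ^ (α - 2) * x ^ (2 - α) := by
    have h1 : ((x / ℓ) ^ kappa α) ^ 2 = (x / ℓ) ^ (2 - α) := by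
      rw [← Real.rpow_natCast, ← Real.rpow_mul hxl.le]
      congr 1
      unfold kappa
      push_cast
      ring
    have h2 : ℓ ^ (α - 2) = (ℓ ^ (2 - α))⁻¹ := by rw [← Real.rpow_neg hℓ.le]; congr 1; ring
    rw [mul_pow, h1, Real.div_rpow hx.le hℓ.le, h2]
    ring
  have e2 : (j * (x / ℓ) ^ kappa α / 2) ^ nuIndex α =
      (j / 2) ^ nuIndex α * (x ^ ((α - 1) / 2) / ℓ ^ ((α - 1) / 2)) := by
    rw [mul_div_right_comm, Real.mul_rpow (by positivity) (by positivity), ← Real.rpow_mul hxl.le,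
      kappa_mul_nuIndex hα2, Real.div_rpow hx.le hℓ.le]
  have e3 : x ^ ((1 - α) / 2) * x ^ ((α - 1) / 2) = 1 := by
    rw [← Real.rpow_add hx, ← Real.rpow_zero x]
    congr 1
    ring
  rw [besselJ_eq (by positivity), e1, e2]
  generalize besselEntire (nuIndex α) (j ^ 2 / 4 * ℓ ^ (α - 2) * x ^ (2 - α)) = F
  linear_combination (√(2 * kappa α) / (ℓ ^ kappa α * |deriv (besselJ (nuIndex α)) j|) *
    ((j / 2) ^ nuIndex α / ℓ ^ ((α - 1) / 2)) * F) * e3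

lemma eigenPhiFactor_sq {ℓ α j : ℝ} (hℓ : 0 < ℓ) (hα1 : 1 ≤ α) (hα2 : α < 2) (hj : 0 < j)
    (h0 : besselEntire (nuIndex α) (j ^ 2 / 4) = 0)
    (h1 : besselEntire (nuIndex α + 1) (j ^ 2 / 4) ≠ 0) :
    eigenPhiFactor ℓ α j ^ 2 =
      (2 - α) / (ℓ * (j ^ 2 / 4) * besselEntire (nuIndex α + 1) (j ^ 2 / 4) ^ 2) := by
  unfold eigenPhiFactor
  rw [deriv_besselJ_of_zero (nuIndex_nonneg hα1 hα2) hj h0]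
  have hJ : 0 < (j / 2) ^ nuIndex α := Real.rpow_pos_of_pos (by positivity) _
  have e : (ℓ ^ kappa α) ^ 2 * (ℓ ^ ((α - 1) / 2)) ^ 2 = ℓ := by
    rw [← mul_pow, ← Real.rpow_add hℓ, ← Real.rpow_natCast, ← Real.rpow_mul hℓ.le]
    have : (kappa α + (α - 1) / 2) * ((2 : ℕ) : ℝ) = 1 := by
      unfold kappa
      push_cast
      ring
    rw [this, Real.rpow_one]
  have hκ : 2 * kappa α = 2 - α := by unfold kappa; ring
  have hA : 0 < ℓ ^ kappa α := Real.rpow_pos_of_pos hℓ _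
  have hB : 0 < ℓ ^ ((α - 1) / 2) := Real.rpow_pos_of_pos hℓ _
  rw [mul_pow, div_pow, div_pow, mul_pow, sq_abs, Real.sq_sqrt (by rw [hκ]; linarith), hκ]
  -- The third occurrence of ℓ is the bare one in the right-hand denominator.
  nth_rewrite 3 [← e]
  field_simp
  ring

/-- The lower bound for the mass in `(a, b)` of `Φ_{α,m}`. -/
theorem eigenPhi_mass_lower_bound {a b ℓ α : ℝ} {m : ℕ} (ha : 0 < a) (hab : a < b) (hbℓ : b < ℓ)
    (hα1 : 1 ≤ α) (hα2 : α < 2) (hm : 1 ≤ m) :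
    massConstant a b ℓ * (2 - α) ≤ ∫ x in a..b, eigenPhi ℓ α m x ^ 2 := by
  have hℓ : 0 < ℓ := ha.trans (hab.trans hbℓ)
  have hν := nuIndex_nonneg hα1 hα2
  obtain ⟨n, rfl⟩ : ∃ n, m = n + 1 := ⟨m - 1, by omega⟩
  obtain ⟨hj, hj0⟩ := besselZero_succ_spec hν (besselZero_nonneg hν n)
  set j := besselZero (nuIndex α) (n + 1) with hjdef
  set c := j ^ 2 / 4 * ℓ ^ (α - 2) with hc
  have hℓℓ : ℓ ^ (α - 2) * ℓ ^ (2 - α) = 1 := by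
    rw [← Real.rpow_add hℓ, ← Real.rpow_zero ℓ]
    congr 1
    ring
  have hcℓ : c * ℓ ^ (2 - α) = j ^ 2 / 4 := by rw [hc, mul_assoc, hℓℓ, mul_one]
  have hc0 : 0 < c := by positivity
  have hsol := isFluxSolution_besselEntire (ℓ := ℓ) (c := c) hα1 hα2 (by rw [hcℓ, hj0])
  have hu0c := continuous_besselEntire_rpow (c := c) hν hα2
  have hlim := fluxProductLimsupNonneg_of_continuous hu0c
    (p := fun x => -(c * (2 - α) * (x * besselEntire (nuIndex α + 1) (c * x ^ (2 - α)))))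
    (continuous_const.mul (continuous_id.mul
      (continuous_besselEntire_rpow (by linarith) hα2))).neg (by simp)
  have hne : ∃ x ∈ Ioo 0 ℓ, besselEntire (nuIndex α) (c * x ^ (2 - α)) ≠ 0 := by
    have h00 : besselEntire (nuIndex α) (c * (0 : ℝ) ^ (2 - α)) ≠ 0 := by
      rw [Real.zero_rpow (by linarith), mul_zero]
      exact (besselEntire_zero_pos hν).ne'
    obtain ⟨δ, hδ, hball⟩ := Metric.eventually_nhds_iff.1 ((hu0c.tendsto 0).eventually_ne h00)
    have hmin : 0 < min δ ℓ := lt_min hδ hℓ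
    refine ⟨min δ ℓ / 2, ⟨by positivity, by linarith [min_le_right δ ℓ]⟩, hball ?_⟩
    rw [Real.dist_eq, sub_zero, abs_of_pos (by positivity)]
    linarith [min_le_left δ ℓ]
  have hμ := hsol.one_le_eigenvalue hα2 hlim hne
  have h2α : 0 < 2 - α := by linarith
  have hμ0 : 0 < (2 - α) ^ 2 * c := by positivity
  -- Simplicity of the zero: otherwise u and p would both vanish at ℓ, and backward uniqueness would
  -- give u = 0.
  have hF : besselEntire (nuIndex α + 1) (j ^ 2 / 4) ≠ 0 := by
    intro hF
    obtain ⟨x, hx, hux⟩ := hne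
    have h := hsol.monotoneOn_sq_add (by linarith) hμ0.le ⟨hx.1, hx.2.le⟩ ⟨hℓ, le_rfl⟩ hx.2.le
    simp only [hcℓ, hF, hj0, mul_zero, neg_zero] at h
    have hA := Real.rpow_pos_of_pos hx.1 α
    have h1 : 0 < (2 - α) ^ 2 * c *
        (x ^ α * besselEntire (nuIndex α) (c * x ^ (2 - α)) ^ 2) := by positivity
    have h2 := sq_nonneg (-(c * (2 - α) * (x * besselEntire (nuIndex α + 1) (c * x ^ (2 - α)))))
    norm_num at h h2
    linarith
  have hsol' := hsol.const_mul (eigenPhiFactor ℓ α j)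
  -- An equality: the prefactor of Φ is exactly the one for which the flux at ℓ has the size that
  -- normalization would give.
  have hE : (2 - α) * ((2 - α) ^ 2 * c) ≤ ℓ * energyDensity α ((2 - α) ^ 2 * c)
      (fun x => eigenPhiFactor ℓ α j * besselEntire (nuIndex α) (c * x ^ (2 - α)))
      (fun x => eigenPhiFactor ℓ α j *
        -(c * (2 - α) * (x * besselEntire (nuIndex α + 1) (c * x ^ (2 - α))))) ℓ := by
    refine le_of_eq ?_
    simp only [energyDensity, hcℓ, hj0]
    rw [mul_pow, eigenPhiFactor_sq hℓ hα1 hα2 hj hj0 hF]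
    have e : ℓ ^ (2 - α) = ℓ ^ 2 * ℓ ^ (-α) := by
      rw [sub_eq_add_neg, Real.rpow_add hℓ]; norm_num
    rw [e] at hcℓ
    rw [← hcℓ] at hF ⊢
    generalize besselEntire (nuIndex α + 1) (c * (ℓ ^ 2 * ℓ ^ (-α))) = F at hF ⊢
    have hA := (Real.rpow_pos_of_pos hℓ (-α)).ne'
    field_simp
    ring
  have hmain := hsol'.mass_lower_bound ha hab hbℓ hα1 hα2 hμ hE
  refine hmain.trans_eq (intervalIntegral.integral_congr fun x hx => ?_)
  rw [uIcc_of_le hab.le] at hx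
  rw [eigenPhi_eq hℓ hα2 (ha.trans_le hx.1) hj]

end DegenerateDiffusion

theorem mainTheorem5 (a b ℓ : ℝ) (ha : 0 < a) (hab : a < b) (hbℓ : b < ℓ) :
    ∃ γ : ℝ, 0 < γ ∧ ∀ α : ℝ, 1 ≤ α → α < 2 →
      (∀ m : ℕ, 1 ≤ m →
        γ * (2 - α) ≤ ∫ x in a..b, DegenerateDiffusion.eigenPhi ℓ α m x ^ 2) ∧
      (∀ (μ : ℝ) (u : ℝ → ℝ), DegenerateDiffusion.IsNormalizedEigenfunction ℓ α μ u →
        γ * (2 - α) ≤ ∫ x in a..b, u x ^ 2) :=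
  ⟨DegenerateDiffusion.massConstant a b ℓ,
    DegenerateDiffusion.massConstant_pos hab (ha.trans (hab.trans hbℓ)), fun _ hα1 hα2 =>
    ⟨fun _ hm => DegenerateDiffusion.eigenPhi_mass_lower_bound ha hab hbℓ hα1 hα2 hm,
      fun _ _ hu => hu.mass_lower_bound ha hab hbℓ hα1 hα2⟩⟩
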